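/- **Setting.** Let $\mathcal X$, $\mathcal Y$ be measurable spaces and $d, m \ge 1$, $s \ge 0$, $r$ integers. Each $x\in\mathcal X$ has a finite nonempty set $\mathcal Y(x)\subseteq\mathcal Y$ of feasible outputs with $|\mathcal Y(x)|\le r$, and $\phi(x,y)\in\mathbb R^d$ is a feature vector. Let $\mathcal W$ be the set of $w\in\mathbb R^d$ with at most $s$ nonzero coordinates. Let $\beta(m,w)>0$ be an arbitrary scale parameter that may depend on $m$ and $w$. Let $(\gamma_y)_{y\in\mathcal Y(x)}$ be i.i.d. Gumbel variables with location $0$ and scale $\beta(m,w)$, i.e. with density $t\mapsto \beta^{-1}\exp(-t/\beta-e^{-t/\beta})$ at $\beta=\beta(m,w)$, and define the stochastic decoder $$f_{w,\gamma}(x)\in\operatorname*{arg\,max}_{y\in\mathcal Y(x)}\ \langle\phi(x,y),w\rangle+\gamma_y$$ (ties have probability zero). For a probability distribution $\mathcal D$ on $\mathcal X\times\mathcal Y$ and a sample $S=((x_1,y_1),\dots,(x_m,y_m))$ put $$L(w,\mathcal D)=\mathbb E_{(x,y)\sim\mathcal D}\big[\Pr_\gamma\{f_{w,\gamma}(x)\ne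 y\}\big],\qquad L(w,S)=\frac1m\sum_{i=1}^m\Pr_\gamma\{f_{w,\gamma}(x_i)\neq y_i\},$$ the expected perturbed zero-one loss and the empirical CRF loss. Assume that for each $w\in\mathcal W$ the function $(x,y)\mapsto\Pr_\gamma\{f_{w,\gamma}(x)\ne y\}$ is measurable. **Theorem (Rademacher based generalization bound).** Let $\delta\in(0,1)$. If $S$ consists of $m$ i.i.d. samples from $\mathcal D$, then the event $$\forall w\in\mathcal W:\quad L(w,\mathcal D)\le L(w,S)+2\sqrt{\frac{s\,(\ln d+2\ln(mr))}{m}}+3\sqrt{\frac{\ln(2/\delta)}{2m}}$$ is measurable and has probability at least $1-\delta$. -/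

import Mathlib

open MeasureTheory

namespace PerturbMAP

noncomputable section

/-- The Gumbel distribution on the real line with location `0` and scale `β` (for `0 < β`), given
by its density `t ↦ β⁻¹ * exp (-(t / β) - exp (-(t / β)))`. -/
def gumbel (β : ℝ) : Measure ℝ :=
  volume.withDensity fun t =>
    ENNReal.ofReal (β⁻¹ * Real.exp (-(t / β) - Real.exp (-(t / β))))

/-- `w` has at most `s` nonzero coordinates. -/
def IsSparse {d : ℕ} (s : ℕ) (w : EuclideanSpace ℝ (Fin d)) : Prop :=
  {j : Fin d | w j ≠ 0}.ncard ≤ s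

variable {X Y : Type*} {d : ℕ}

/-- The Gumbel noise at the input `x`: one independent Gumbel variable with scale `β` for each
feasible output in `out x`. -/
def noise (out : X → Finset Y) (β : ℝ) (x : X) : Measure (out x → ℝ) :=
  Measure.pi fun _ => gumbel β

/-- The score `⟨φ(x, y), w⟩ + γ_y` of the feasible output `y` of `x` under the noise `γ`. -/
def perturbedScore (out : X → Finset Y) (φ : X → Y → EuclideanSpace ℝ (Fin d))
    (w : EuclideanSpace ℝ (Fin d)) (x : X) (γ : out x → ℝ) (y : out x) : ℝ :=
  inner ℝ (φ x y) w + γ y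

theorem exists_argmax {out : X → Finset Y} (hout : ∀ x, (out x).Nonempty)
    (φ : X → Y → EuclideanSpace ℝ (Fin d)) (w : EuclideanSpace ℝ (Fin d)) (x : X)
    (γ : out x → ℝ) :
    ∃ y : out x, ∀ y' : out x, perturbedScore out φ w x γ y' ≤ perturbedScore out φ w x γ y :=
  haveI : Nonempty (out x) := (hout x).to_subtype
  Finite.exists_max (perturbedScore out φ w x γ)

/-- The stochastic decoder: a feasible output of maximal perturbed score (ties, which have
probability zero under the noise, are broken by choice). -/
def decoder {out : X → Finset Y} (hout : ∀ x, (out x).Nonempty)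
    (φ : X → Y → EuclideanSpace ℝ (Fin d)) (w : EuclideanSpace ℝ (Fin d)) (x : X)
    (γ : out x → ℝ) : Y :=
  ((exists_argmax hout φ w x γ).choose : out x)

/-- The probability, over Gumbel noise of scale `β`, that the stochastic decoder with weights `w`
errs on the labelled example `p = (x, y)`. -/
def errorProb {out : X → Finset Y} (hout : ∀ x, (out x).Nonempty)
    (φ : X → Y → EuclideanSpace ℝ (Fin d)) (β : ℝ) (w : EuclideanSpace ℝ (Fin d))
    (p : X × Y) : ℝ :=
  (noise out β p.1).real {γ | p.2 ≠ decoder hout φ w p.1 γ}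

/-- The expected perturbed zero-one loss under the data distribution `D`. -/
def expectedLoss [MeasurableSpace X] [MeasurableSpace Y]
    {out : X → Finset Y} (hout : ∀ x, (out x).Nonempty)
    (φ : X → Y → EuclideanSpace ℝ (Fin d)) (β : ℝ) (w : EuclideanSpace ℝ (Fin d))
    (D : Measure (X × Y)) : ℝ :=
  ∫ p, errorProb hout φ β w p ∂D

/-- The empirical perturbed zero-one loss (CRF loss) on the sample `S`. -/
def empiricalLoss {out : X → Finset Y} (hout : ∀ x, (out x).Nonempty)
    (φ : X → Y → EuclideanSpace ℝ (Fin d)) (β : ℝ) (w : EuclideanSpace ℝ (Fin d))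
    {m : ℕ} (S : Fin m → X × Y) : ℝ :=
  (1 / (m : ℝ)) * ∑ i, errorProb hout φ β w (S i)

/-- The statistical error term `ε(d, s, m, r, δ)`. -/
def epsilon (d s m r : ℕ) (δ : ℝ) : ℝ :=
  2 * √((s * (Real.log d + 2 * Real.log (m * r))) / m) + 3 * √(Real.log (2 / δ) / (2 * m))

end

end PerturbMAP

/-!
For a fixed scale `β` the Gumbel noise is `β` times a standard one, so weights `w` with scale
`β m w` err exactly as often as the weights `(β m w)⁻¹ • w` under standard noise, and these are as
sparse as `w` (`errorProb_eq_errorProb_one`). The dependence of the scale on `m` and `w` is thereby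
absorbed into the weights. Under standard noise ties are null events, hence the error probability
is continuous in the weights (`continuous_errorProb_one`), and a dense sequence of rescaled weights
decides the event. This gives measurability, and it suffices to bound the failure probability for
finitely many weights, uniformly in their number.

For finitely many weights, the exponential moment of the largest deviation is bounded by
symmetrization with a ghost sample (`integral_sup_exp_deviation_le`). The symmetrized quantity is
estimated on each fixed double sample, where Jensen's inequality exchanges the average over the
noise at the `2 * m` inputs with the maximum over the weights (`sum_sup_exp_integral_le`). Fixing
the samples first means that no measurability of the decoder jointly in input and noise is needed.
For fixed noise only the number of distinct zero-one loss vectors matters. The decoder depends on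
the comparisons of perturbed scores, which on a fixed support of size `s` are sign patterns of
affine functions of `s` real parameters. Such patterns have VC dimension at most `s`, and the
Sauer-Shelah lemma bounds their number; there are at most `d ^ s` supports
(`card_decoder_image_le`).

Markov's inequality then bounds the failure probability by `N * exp (-m ε² / 2)` with
`N = (d * (2 * m * (r * (r - 1)) + 1)) ^ s`, and the constants in `epsilon` make this at most `δ`
(`card_patterns_mul_exp_le`).
-/

/-! ### Sign patterns of affine functions and patterns of the decoder -/

namespace PerturbMAP

theorem sum_choose_Iic_le (n k : ℕ) : ∑ i ∈ Finset.Iic k, n.choose i ≤ (n + 1) ^ k := by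
  rw [add_pow, ← Nat.range_succ_eq_Iic]
  refine Finset.sum_le_sum fun i hi => ?_
  have h : 1 ≤ k.choose i := Nat.choose_pos (by simpa [Nat.lt_succ_iff] using hi)
  calc n.choose i ≤ n ^ i := Nat.choose_le_pow _ _
    _ ≤ n ^ i * 1 ^ (k - i) * k.choose i := by
      rw [one_pow, mul_one]; exact Nat.le_mul_of_pos_right _ h

/-- The sign patterns of finitely many affine functions of `s` real parameters have
VC dimension at most `s`: a linear dependence between the linear parts of `s + 1` of the
functions forbids the pattern of its positive part or that of its negative part. -/
theorem card_le_of_shatters_affine {κ : Type*} [DecidableEq κ] {s : ℕ}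
    (a : κ → Fin s → ℝ) (b : κ → ℝ) (A : Finset (Finset κ))
    (hA : ∀ B ∈ A, ∃ c : Fin s → ℝ, ∀ k, k ∈ B ↔ 0 ≤ ∑ j, a k j * c j + b k)
    (T : Finset κ) (hT : A.Shatters T) : T.card ≤ s := by
  by_contra! hlt
  have hdep : ¬ LinearIndependent ℝ fun k : T => a k := fun h => by
    have := h.fintype_card_le_finrank
    simp at this
    omega
  obtain ⟨l, hl, k₀, hk₀⟩ := Fintype.not_linearIndependent_iff.1 hdep
  -- the combination with coefficients `l` of the affine functions does not depend on `c`
  have hconst : ∀ c : Fin s → ℝ,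
      ∑ k : T, l k * (∑ j, a k j * c j + b k) = ∑ k : T, l k * b k := by
    intro c
    simp only [mul_add, Finset.sum_add_distrib, Finset.mul_sum]
    rw [Finset.sum_comm, add_eq_right]
    refine Finset.sum_eq_zero fun j _ => ?_
    have := congrFun hl j
    simp only [Finset.sum_apply, Pi.smul_apply, smul_eq_mul, Pi.zero_apply] at this
    simp only [← mul_assoc]
    rw [← Finset.sum_mul, this, zero_mul]
  have hpat : ∀ P : κ → Prop, ∃ c : Fin s → ℝ, ∀ k : T,
      P k ↔ 0 ≤ ∑ j, a k j * c j + b k := by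
    classical
    intro P
    obtain ⟨B, hB, hBT⟩ := hT (Finset.filter_subset P T)
    obtain ⟨c, hc⟩ := hA B hB
    refine ⟨c, fun k => ?_⟩
    rw [← hc k]
    have := congrArg (fun S => (k : κ) ∈ S) hBT
    simpa using this.symm
  -- `l k` extended by zero outside `T`
  let L : κ → ℝ := fun k => if h : k ∈ T then l ⟨k, h⟩ else 0
  have hL : ∀ k : T, L k = l k := fun k => by simp [L]
  obtain ⟨c, hc⟩ := hpat fun k => 0 < L k
  obtain ⟨c', hc'⟩ := hpat fun k => L k < 0
  have h1 : ∀ k : T, 0 ≤ l k * (∑ j, a k j * c j + b k) := by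
    intro k
    have := hc k
    rw [hL] at this
    by_cases h : 0 < l k
    · exact mul_nonneg h.le (this.1 h)
    · exact mul_nonneg_of_nonpos_of_nonpos (not_lt.1 h)
        (not_le.1 fun h' => h (this.2 h')).le
  have h2 : ∀ k : T, l k * (∑ j, a k j * c' j + b k) ≤ 0 := by
    intro k
    have := hc' k
    rw [hL] at this
    by_cases h : l k < 0
    · exact mul_nonpos_of_nonpos_of_nonneg h.le (this.1 h)
    · exact mul_nonpos_of_nonneg_of_nonpos (not_lt.1 h)
        (not_le.1 fun h' => h (this.2 h')).le
  have e1 := hconst c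
  have e2 := hconst c'
  have n1 := Finset.sum_nonneg fun k (_ : k ∈ Finset.univ) => h1 k
  have n2 := Finset.sum_nonpos fun k (_ : k ∈ Finset.univ) => h2 k
  have z1 := (Finset.sum_eq_zero_iff_of_nonneg fun k (_ : k ∈ Finset.univ) => h1 k).1
    (by linarith) k₀ (Finset.mem_univ _)
  have z2 := (Finset.sum_eq_zero_iff_of_nonpos fun k (_ : k ∈ Finset.univ) => h2 k).1
    (by linarith) k₀ (Finset.mem_univ _)
  have f1 := hc k₀
  have f2 := hc' k₀
  rw [hL] at f1 f2
  rcases lt_or_gt_of_ne hk₀ with h | h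
  · have := not_le.1 fun h' => absurd (f1.2 h') h.not_gt
    exact (mul_pos_of_neg_of_neg h this).ne' z1
  · have := not_le.1 fun h' => absurd (f2.2 h') h.not_gt
    exact (mul_neg_of_pos_of_neg h this).ne z2

theorem card_affine_patterns_le {κ : Type*} [Fintype κ] [DecidableEq κ] {s : ℕ}
    (a : κ → Fin s → ℝ) (b : κ → ℝ) (A : Finset (Finset κ))
    (hA : ∀ B ∈ A, ∃ c : Fin s → ℝ, ∀ k, k ∈ B ↔ 0 ≤ ∑ j, a k j * c j + b k) :
    A.card ≤ (Fintype.card κ + 1) ^ s := by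
  have hdim : A.vcDim ≤ s := Finset.sup_le fun T hT =>
    card_le_of_shatters_affine a b A hA T (Finset.mem_shatterer.1 hT)
  calc A.card ≤ A.shatterer.card := A.card_le_card_shatterer
    _ ≤ ∑ i ∈ Finset.Iic A.vcDim, (Fintype.card κ).choose i :=
      Finset.card_shatterer_le_sum_vcDim
    _ ≤ ∑ i ∈ Finset.Iic s, (Fintype.card κ).choose i :=
      Finset.sum_le_sum_of_subset (Finset.Iic_subset_Iic.2 hdim)
    _ ≤ _ := sum_choose_Iic_le _ _

variable {X Y : Type*} {d : ℕ}

/-- A sparse vector is a combination of `s` coordinate vectors; the coordinates are listed by a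
map `Fin s → Fin d`, possibly with repetitions. -/
theorem IsSparse.exists_inner_eq {s : ℕ} (hd : 1 ≤ d) {w : EuclideanSpace ℝ (Fin d)}
    (hw : IsSparse s w) :
    ∃ (f : Fin s → Fin d) (c : Fin s → ℝ), ∀ v : EuclideanSpace ℝ (Fin d),
      inner ℝ v w = ∑ j, v (f j) * c j := by
  classical
  set S : Finset (Fin d) := Finset.univ.filter fun j => w j ≠ 0 with hS
  have hcard : S.card ≤ s := by
    have : {j : Fin d | w j ≠ 0} = (S : Set (Fin d)) := by ext; simp [hS]
    unfold IsSparse at hw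
    rwa [this, Set.ncard_coe_finset] at hw
  let e : S ↪ Fin s := S.equivFin.toEmbedding.trans (Fin.castLEEmb hcard)
  let f : Fin s → Fin d := Function.extend e (fun j => (j : Fin d)) fun _ => ⟨0, hd⟩
  let c : Fin s → ℝ := Function.extend e (fun j => w j) fun _ => 0
  refine ⟨f, c, fun v => ?_⟩
  have h1 : inner ℝ v w = ∑ j : S, v j * w j := by
    rw [Finset.sum_coe_sort S (fun j => v j * w j), PiLp.inner_apply]
    rw [hS, Finset.sum_filter]
    refine Finset.sum_congr rfl fun j _ => ?_
    by_cases h : w j = 0 <;> simp [h, mul_comm]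
  rw [h1, ← Finset.sum_subset (Finset.subset_univ (Finset.univ.map e)), Finset.sum_map]
  · refine Finset.sum_congr rfl fun j _ => ?_
    simp [f, c, e.injective.extend_apply]
  · intro j _ hj
    have : c j = 0 := Function.extend_apply' _ _ _ fun ⟨a, ha⟩ => hj (by simp [← ha])
    rw [this, mul_zero]

/-- The decoder depends on the noise and the weights only through the comparisons of the perturbed
scores, ties included. -/
theorem decoder_congr {out : X → Finset Y} (hout : ∀ x, (out x).Nonempty)
    (φ : X → Y → EuclideanSpace ℝ (Fin d)) {w w' : EuclideanSpace ℝ (Fin d)} {x : X}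
    {γ γ' : out x → ℝ}
    (h : ∀ y y' : out x, perturbedScore out φ w x γ y' ≤ perturbedScore out φ w x γ y ↔
      perturbedScore out φ w' x γ' y' ≤ perturbedScore out φ w' x γ' y) :
    decoder hout φ w x γ = decoder hout φ w' x γ' := by
  have : (fun y : out x => ∀ y' : out x,
        perturbedScore out φ w x γ y' ≤ perturbedScore out φ w x γ y) =
      fun y => ∀ y' : out x,
        perturbedScore out φ w' x γ' y' ≤ perturbedScore out φ w' x γ' y := by
    ext y
    exact forall_congr' fun y' => h y y'
  unfold decoder
  congr 2

/-- The number of ways in which sparse weights can decode finitely many inputs under fixed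
noise. -/
theorem card_decoder_image_le {s : ℕ} (hd : 1 ≤ d) {out : X → Finset Y}
    (hout : ∀ x, (out x).Nonempty) (φ : X → Y → EuclideanSpace ℝ (Fin d))
    {J : Type*} [Fintype J] [DecidableEq (J → Y)] (x : J → X) (γ : ∀ j, out (x j) → ℝ)
    (V : Finset (EuclideanSpace ℝ (Fin d))) (hV : ∀ w ∈ V, IsSparse s w) :
    (V.image fun w j => decoder hout φ w (x j) (γ j)).card ≤
      (d * (∑ j, ((out (x j)).card * (out (x j)).card - (out (x j)).card) + 1)) ^ s := by
  classical
  let κ := Σ j, {p : out (x j) × out (x j) // p ∈ (Finset.univ : Finset (out (x j))).offDiag}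
  have hκ : Fintype.card κ =
      ∑ j, ((out (x j)).card * (out (x j)).card - (out (x j)).card) := by
    simp only [κ, Fintype.card_sigma, Fintype.card_coe, Finset.offDiag_card, Finset.card_univ]
  let pat : EuclideanSpace ℝ (Fin d) → Finset κ := fun w => Finset.univ.filter fun k =>
    perturbedScore out φ w (x k.1) (γ k.1) k.2.1.2 ≤ perturbedScore out φ w (x k.1) (γ k.1) k.2.1.1
  have hfac : Function.FactorsThrough
      (fun w j => decoder hout φ w (x j) (γ j) : EuclideanSpace ℝ (Fin d) → J → Y) pat := by
    intro w w' h
    funext j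
    refine decoder_congr hout φ fun y y' => ?_
    by_cases hy : y = y'
    · simp [hy]
    · have := congrArg (fun S => (⟨j, (y, y'), by simpa using hy⟩ : κ) ∈ S) h
      simpa only [pat, Finset.mem_filter, Finset.mem_univ, true_and, eq_iff_iff] using this
  have hne : Nonempty (J → Y) := ⟨fun j => (hout (x j)).choose⟩
  obtain ⟨g, hg⟩ := (Function.factorsThrough_iff _).1 hfac
  rw [hg, ← Finset.image_image]
  refine Finset.card_image_le.trans ?_
  let a : (Fin s → Fin d) → κ → Fin s → ℝ := fun f k j =>
    φ (x k.1) k.2.1.1 (f j) - φ (x k.1) k.2.1.2 (f j)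
  let b : κ → ℝ := fun k => γ k.1 k.2.1.1 - γ k.1 k.2.1.2
  let A : (Fin s → Fin d) → Finset (Finset κ) := fun f => Finset.univ.filter fun B =>
    ∃ c : Fin s → ℝ, ∀ k, k ∈ B ↔ 0 ≤ ∑ j, a f k j * c j + b k
  have hsub : V.image pat ⊆ Finset.univ.biUnion A := by
    intro B hB
    obtain ⟨w, hw, rfl⟩ := Finset.mem_image.1 hB
    obtain ⟨f, c, hfc⟩ := (hV w hw).exists_inner_eq hd
    refine Finset.mem_biUnion.2 ⟨f, Finset.mem_univ _, ?_⟩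
    simp only [A, Finset.mem_filter, Finset.mem_univ, true_and]
    refine ⟨c, fun k => ?_⟩
    simp only [pat, Finset.mem_filter, Finset.mem_univ, true_and, perturbedScore, hfc, a, b,
      sub_mul, Finset.sum_sub_distrib]
    rw [← sub_nonneg]
    ring_nf
  calc (V.image pat).card ≤ (Finset.univ.biUnion A).card := Finset.card_le_card hsub
    _ ≤ (Finset.univ : Finset (Fin s → Fin d)).card * (Fintype.card κ + 1) ^ s :=
      Finset.card_biUnion_le_card_mul _ _ _ fun f _ =>
        card_affine_patterns_le (a f) b _ fun B hB => (Finset.mem_filter.1 hB).2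
    _ = _ := by
      rw [hκ, Finset.card_univ, Fintype.card_fun, Fintype.card_fin, Fintype.card_fin, mul_pow]

end PerturbMAP

/-! ### Gumbel noise -/

namespace PerturbMAP

/-- A Gumbel variable of scale `β` is `β` times a standard one. -/
theorem map_mul_gumbel_one {β : ℝ} (hβ : 0 < β) :
    (gumbel 1).map (fun t => β * t) = gumbel β := by
  ext S hS
  have hm : Measurable fun t : ℝ => β * t := by fun_prop
  rw [Measure.map_apply hm hS, gumbel, gumbel, withDensity_apply _ (hm hS),
    withDensity_apply _ hS]
  have hderiv : ∀ t, HasDerivAt (fun t : ℝ => β * t) (β * 1) t := fun t =>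
    (hasDerivAt_id t).const_mul β
  have himg : (fun t : ℝ => β * t) '' ((fun t => β * t) ⁻¹' S) = S :=
    Set.image_preimage_eq _ fun t => ⟨t / β, by field_simp⟩
  nth_rw 2 [← himg]
  rw [lintegral_image_eq_lintegral_abs_deriv_mul (hm hS)
    (fun t _ => (hderiv t).hasDerivWithinAt)
    (mul_right_injective₀ hβ.ne').injOn]
  refine lintegral_congr fun t => ?_
  rw [← ENNReal.ofReal_mul (abs_nonneg _)]
  congr 1
  rw [mul_one, abs_of_pos hβ, mul_div_cancel_left₀ _ hβ.ne', ← mul_assoc,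
    mul_inv_cancel₀ hβ.ne']
  simp

/-- The distribution function `t ↦ exp (-exp (-t))` maps the real line onto `(0, 1)` and has the
Gumbel density as its derivative. -/
theorem gumbel_one_univ : gumbel 1 Set.univ = 1 := by
  have hd : ∀ t : ℝ, HasDerivAt (fun t : ℝ => Real.exp (-Real.exp (-t)))
      (Real.exp (-t - Real.exp (-t))) t := by
    intro t
    convert! ((hasDerivAt_neg t).exp.neg).exp using 1
    rw [sub_eq_add_neg, Real.exp_add]
    simp [mul_comm]
  have hinj : Function.Injective fun t : ℝ => Real.exp (-Real.exp (-t)) := by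
    intro t t' h
    simpa using h
  have himg : (fun t : ℝ => Real.exp (-Real.exp (-t))) '' Set.univ = Set.Ioo 0 1 := by
    ext y
    simp only [Set.image_univ, Set.mem_range, Set.mem_Ioo]
    constructor
    · rintro ⟨t, rfl⟩
      exact ⟨Real.exp_pos _, by simpa using Real.exp_pos _⟩
    · rintro ⟨h0, h1⟩
      refine ⟨-Real.log (-Real.log y), ?_⟩
      have : 0 < -Real.log y := neg_pos.2 (Real.log_neg h0 h1)
      rw [neg_neg, Real.exp_log this, neg_neg, Real.exp_log h0]
  have h := lintegral_image_eq_lintegral_abs_deriv_mul MeasurableSet.univ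
    (fun t _ => (hd t).hasDerivWithinAt) hinj.injOn (fun _ => (1 : ENNReal))
  rw [himg] at h
  rw [gumbel, withDensity_apply _ MeasurableSet.univ]
  have hvol : ∫⁻ _ in Set.Ioo (0 : ℝ) 1, (1 : ENNReal) = 1 := by simp
  rw [← hvol, h]
  refine lintegral_congr fun t => ?_
  rw [abs_of_pos (Real.exp_pos _)]
  simp

instance gumbel.instIsProbabilityMeasure : IsProbabilityMeasure (gumbel 1) := ⟨gumbel_one_univ⟩

instance gumbel.instNullSingletonClass (β : ℝ) : NullSingletonClass (gumbel β) := by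
  unfold gumbel
  infer_instance

variable {X Y : Type*}

instance noise.instIsProbabilityMeasure (out : X → Finset Y) (x : X) :
    IsProbabilityMeasure (noise out 1 x) := by
  unfold noise
  infer_instance

theorem map_smul_noise_one (out : X → Finset Y) {β : ℝ} (hβ : 0 < β) (x : X) :
    (noise out 1 x).map (fun γ y => β * γ y) = noise out β x := by
  have : ∀ _ : out x, SigmaFinite ((gumbel 1).map fun t => β * t) := fun _ =>
    have := Measure.isProbabilityMeasure_map (μ := gumbel 1)
      (f := fun t => β * t) (by fun_prop)
    inferInstance
  unfold noise
  rw [← map_mul_gumbel_one hβ]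
  exact Measure.pi_map_pi fun _ => by fun_prop

/-- Two different coordinates of the noise almost surely do not differ by a given constant. -/
theorem noise_tie_null (out : X → Finset Y) (x : X) {y y' : out x} (h : y ≠ y') (c : ℝ) :
    noise out 1 x {γ | γ y - γ y' = c} = 0 := by
  have hind : ProbabilityTheory.IndepFun (fun γ : out x → ℝ => γ y) (fun γ => γ y')
      (noise out 1 x) :=
    (ProbabilityTheory.iIndepFun_pi (X := fun _ => id) fun _ => aemeasurable_id).indepFun h
  have hmap : ∀ y : out x, (noise out 1 x).map (fun γ => γ y) = gumbel 1 := fun y =>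
    (measurePreserving_eval (fun _ : out x => gumbel 1) y).map_eq
  rw [ProbabilityTheory.indepFun_iff_map_prod_eq_prod_map_map (measurable_pi_apply y).aemeasurable
      (measurable_pi_apply y').aemeasurable,
    hmap, hmap] at hind
  have hS : MeasurableSet {p : ℝ × ℝ | p.1 - p.2 = c} :=
    measurableSet_eq_fun (by fun_prop) (by fun_prop)
  have : noise out 1 x {γ | γ y - γ y' = c} =
      ((noise out 1 x).map fun γ => (γ y, γ y')) {p : ℝ × ℝ | p.1 - p.2 = c} := by
    rw [Measure.map_apply (by fun_prop) hS]
    rfl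
  rw [this, hind, Measure.measure_prod_null hS]
  refine Filter.Eventually.of_forall fun t => ?_
  have : Prod.mk t ⁻¹' {p : ℝ × ℝ | p.1 - p.2 = c} ⊆ {t - c} := by
    intro t' ht'
    simp only [Set.mem_preimage, Set.mem_ofPred_eq] at ht'
    simp only [Set.mem_singleton_iff]
    linarith
  exact measure_mono_null this (measure_singleton _)

end PerturbMAP

/-! ### Symmetrization and exponential moments over finite classes -/

namespace PerturbMAP

/-- The Rademacher sign attached to a Boolean. -/
def boolSign (b : Bool) : ℝ := if b then 1 else -1

theorem abs_boolSign (b : Bool) : |boolSign b| = 1 := by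
  cases b <;> simp [boolSign]

theorem sum_exp_boolSign_le {m : ℕ} (v : Fin m → ℝ) (hv : ∀ i, |v i| ≤ 1) (t : ℝ) :
    ∑ σ : Fin m → Bool, Real.exp (t * ∑ i, boolSign (σ i) * v i) ≤
      2 ^ m * Real.exp (m * t ^ 2 / 2) := by
  have h1 : ∀ σ : Fin m → Bool, Real.exp (t * ∑ i, boolSign (σ i) * v i) =
      ∏ i, Real.exp (t * (boolSign (σ i) * v i)) := by
    intro σ
    rw [Finset.mul_sum, Real.exp_sum]
  have h2 : ∀ i, ∑ b : Bool, Real.exp (t * (boolSign b * v i)) ≤ 2 * Real.exp (t ^ 2 / 2) := by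
    intro i
    have : ∑ b : Bool, Real.exp (t * (boolSign b * v i)) = 2 * Real.cosh (t * v i) := by
      rw [Fintype.sum_bool, Real.cosh_eq]
      simp [boolSign]
      ring
    rw [this]
    have hle : (t * v i) ^ 2 ≤ t ^ 2 := by
      rw [mul_pow]
      exact mul_le_of_le_one_right (sq_nonneg _) ((sq_le_one_iff_abs_le_one _).2 (hv i))
    gcongr
    exact (Real.cosh_le_exp_half_sq _).trans (by gcongr)
  simp_rw [h1]
  rw [← Fintype.prod_sum fun i (b : Bool) => Real.exp (t * (boolSign b * v i))]
  calc ∏ i, ∑ b : Bool, Real.exp (t * (boolSign b * v i))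
      ≤ ∏ _i : Fin m, 2 * Real.exp (t ^ 2 / 2) :=
        Finset.prod_le_prod (fun i _ => Finset.sum_nonneg fun b _ => (Real.exp_pos _).le)
          fun i _ => h2 i
    _ = _ := by
      rw [Finset.prod_const, Finset.card_univ, Fintype.card_fin, mul_pow, ← Real.exp_nat_mul]
      ring_nf

variable {ι : Type*} [Fintype ι] [Nonempty ι]

/-- The exponential-moment form of Massart's finite class lemma: only the number of distinct
vectors of the family matters. -/
theorem sum_sup_exp_boolSign_le {m : ℕ} (v : ι → Fin m → ℝ) (hv : ∀ k i, |v k i| ≤ 1) {N : ℕ}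
    [DecidableEq (Fin m → ℝ)] (hN : (Finset.univ.image v).card ≤ N) (t : ℝ) :
    ∑ σ : Fin m → Bool, Finset.univ.sup' Finset.univ_nonempty
        (fun k => Real.exp (t * ∑ i, boolSign (σ i) * v k i)) ≤
      2 ^ m * (N * Real.exp (m * t ^ 2 / 2)) := by
  calc _ ≤ ∑ σ : Fin m → Bool, ∑ a ∈ Finset.univ.image v,
        Real.exp (t * ∑ i, boolSign (σ i) * a i) := by
        refine Finset.sum_le_sum fun σ _ => Finset.sup'_le _ _ fun k _ => ?_
        exact Finset.single_le_sum
          (f := fun a : Fin m → ℝ => Real.exp (t * ∑ i, boolSign (σ i) * a i))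
          (fun a _ => (Real.exp_pos _).le) (Finset.mem_image_of_mem v (Finset.mem_univ k))
    _ = ∑ a ∈ Finset.univ.image v, ∑ σ : Fin m → Bool,
        Real.exp (t * ∑ i, boolSign (σ i) * a i) := Finset.sum_comm
    _ ≤ ∑ a ∈ Finset.univ.image v, 2 ^ m * Real.exp (m * t ^ 2 / 2) := by
        refine Finset.sum_le_sum fun a ha => ?_
        obtain ⟨k, -, rfl⟩ := Finset.mem_image.1 ha
        exact sum_exp_boolSign_le _ (hv k) t
    _ = (Finset.univ.image v).card * (2 ^ m * Real.exp (m * t ^ 2 / 2)) := by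
        rw [Finset.sum_const, nsmul_eq_mul]
    _ ≤ N * (2 ^ m * Real.exp (m * t ^ 2 / 2)) := by gcongr
    _ = _ := by ring

theorem le_sup'_univ (f : ι → ℝ) (k : ι) : f k ≤ Finset.univ.sup' Finset.univ_nonempty f :=
  Finset.le_sup' f (Finset.mem_univ k)

theorem measurable_sup'_univ {Ω : Type*} [MeasurableSpace Ω] {f : ι → Ω → ℝ}
    (hf : ∀ k, Measurable (f k)) :
    Measurable fun ω => Finset.univ.sup' Finset.univ_nonempty fun k => f k ω := by
  convert! Finset.measurable_sup' (Finset.univ_nonempty (α := ι)) fun k _ => hf k using 1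
  ext ω
  rw [Finset.sup'_apply]

/-- Bounded exponents make a maximum of exponentials integrable. -/
theorem integrable_sup_exp {Ω : Type*} [MeasurableSpace Ω] (μ : Measure Ω) [IsFiniteMeasure μ]
    {f : ι → Ω → ℝ} (hf : ∀ k, Measurable (f k)) {C : ℝ} (hC : ∀ k ω, f k ω ≤ C) :
    Integrable (fun ω => Finset.univ.sup' Finset.univ_nonempty fun k => Real.exp (f k ω)) μ := by
  refine Integrable.of_bound
    (measurable_sup'_univ fun k => (hf k).exp).aestronglyMeasurable (Real.exp C) ?_
  refine Filter.Eventually.of_forall fun ω => ?_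
  have h0 : 0 ≤ Finset.univ.sup' Finset.univ_nonempty fun k => Real.exp (f k ω) :=
    (Real.exp_pos _).le.trans (le_sup'_univ (fun k => Real.exp (f k ω)) (Classical.arbitrary ι))
  rw [Real.norm_of_nonneg h0]
  exact Finset.sup'_le _ _ fun k _ => Real.exp_le_exp.2 (hC k ω)

theorem integrable_of_abs_le {Ω : Type*} [MeasurableSpace Ω] (μ : Measure Ω)
    [IsFiniteMeasure μ] {f : Ω → ℝ} (hf : Measurable f) {C : ℝ} (hC : ∀ ω, |f ω| ≤ C) :
    Integrable f μ :=
  Integrable.of_bound hf.aestronglyMeasurable C (Filter.Eventually.of_forall hC)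

theorem integral_le_one {Ω : Type*} [MeasurableSpace Ω] (μ : Measure Ω)
    [IsProbabilityMeasure μ] {f : Ω → ℝ} (hf : Measurable f) (h0 : ∀ ω, 0 ≤ f ω)
    (h1 : ∀ ω, f ω ≤ 1) : ∫ ω, f ω ∂μ ≤ 1 := by
  calc ∫ ω, f ω ∂μ ≤ ∫ _, (1 : ℝ) ∂μ :=
        integral_mono (integrable_of_abs_le (C := 1) μ hf fun ω => by
          rw [abs_of_nonneg (h0 ω)]; exact h1 ω) (integrable_const _) h1
    _ = 1 := by simp

/-- Jensen's inequality for a maximum of exponentials. -/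
theorem sup_exp_integral_le {Ω : Type*} [MeasurableSpace Ω] (μ : Measure Ω)
    [IsProbabilityMeasure μ] {f : ι → Ω → ℝ} (hf : ∀ k, Measurable (f k)) {C : ℝ}
    (hC : ∀ k ω, |f k ω| ≤ C) :
    Finset.univ.sup' Finset.univ_nonempty (fun k => Real.exp (∫ ω, f k ω ∂μ)) ≤
      ∫ ω, Finset.univ.sup' Finset.univ_nonempty (fun k => Real.exp (f k ω)) ∂μ := by
  have hC' : ∀ k ω, f k ω ≤ C := fun k ω => (le_abs_self _).trans (hC k ω)
  refine Finset.sup'_le _ _ fun k _ => ?_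
  have hexp : Integrable (fun ω => Real.exp (f k ω)) μ :=
    integrable_of_abs_le (C := Real.exp C) μ (hf k).exp fun ω => by
      rw [abs_of_pos (Real.exp_pos _)]
      exact Real.exp_le_exp.2 (hC' k ω)
  calc Real.exp (∫ ω, f k ω ∂μ) ≤ ∫ ω, Real.exp (f k ω) ∂μ :=
        convexOn_exp.map_integral_le Real.continuous_exp.continuousOn isClosed_univ
          (Filter.Eventually.of_forall fun _ => Set.mem_univ _)
          (integrable_of_abs_le μ (hf k) (hC k)) hexp
    _ ≤ _ := integral_mono hexp (integrable_sup_exp μ hf hC') fun ω =>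
        le_sup'_univ (fun k => Real.exp (f k ω)) k

theorem abs_mul_sum_boolSign_le {m : ℕ} (t : ℝ) (σ : Fin m → Bool) {v : Fin m → ℝ}
    (hv : ∀ i, |v i| ≤ 1) : |t * ∑ i, boolSign (σ i) * v i| ≤ |t| * m := by
  rw [abs_mul]
  gcongr
  calc |∑ i, boolSign (σ i) * v i| ≤ ∑ i, |boolSign (σ i) * v i| :=
        Finset.abs_sum_le_sum_abs _ _
    _ ≤ ∑ _i : Fin m, (1 : ℝ) := Finset.sum_le_sum fun i _ => by
        rw [abs_mul, abs_boolSign, one_mul]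
        exact hv i
    _ = m := by simp

/-- The finite class bound passes to averages of the vectors: it suffices to count the vectors for
each value of the averaged variable. -/
theorem sum_sup_exp_integral_le {Ω : Type*} [MeasurableSpace Ω] (μ : Measure Ω)
    [IsProbabilityMeasure μ] {m : ℕ} (v : ι → Fin m → Ω → ℝ) (hmeas : ∀ k i, Measurable (v k i))
    (hv : ∀ k i ω, |v k i ω| ≤ 1) {N : ℕ} [DecidableEq (Fin m → ℝ)]
    (hN : ∀ ω, (Finset.univ.image fun k i => v k i ω).card ≤ N) (t : ℝ) :
    ∑ σ : Fin m → Bool, Finset.univ.sup' Finset.univ_nonempty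
        (fun k => Real.exp (t * ∑ i, boolSign (σ i) * ∫ ω, v k i ω ∂μ)) ≤
      2 ^ m * (N * Real.exp (m * t ^ 2 / 2)) := by
  have hint : ∀ (σ : Fin m → Bool) k, t * ∑ i, boolSign (σ i) * ∫ ω, v k i ω ∂μ =
      ∫ ω, t * ∑ i, boolSign (σ i) * v k i ω ∂μ := by
    intro σ k
    rw [integral_const_mul, integral_finsetSum]
    · simp_rw [integral_const_mul]
    · exact fun i _ => (integrable_of_abs_le μ (hmeas k i) (hv k i)).const_mul _
  have hm : ∀ (σ : Fin m → Bool) k,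
      Measurable fun ω => t * ∑ i, boolSign (σ i) * v k i ω := by
    intro σ k
    fun_prop
  have hb : ∀ (σ : Fin m → Bool) k ω, |t * ∑ i, boolSign (σ i) * v k i ω| ≤ |t| * m :=
    fun σ k ω => abs_mul_sum_boolSign_le t σ fun i => hv k i ω
  have hi : ∀ σ : Fin m → Bool, Integrable (fun ω => Finset.univ.sup' Finset.univ_nonempty
      fun k => Real.exp (t * ∑ i, boolSign (σ i) * v k i ω)) μ := fun σ =>
    integrable_sup_exp μ (hm σ) fun k ω => (le_abs_self _).trans (hb σ k ω)
  simp_rw [hint]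
  calc _ ≤ ∑ σ : Fin m → Bool, ∫ ω, Finset.univ.sup' Finset.univ_nonempty
        (fun k => Real.exp (t * ∑ i, boolSign (σ i) * v k i ω)) ∂μ :=
        Finset.sum_le_sum fun σ _ => sup_exp_integral_le μ (hm σ) (hb σ)
    _ = ∫ ω, ∑ σ : Fin m → Bool, Finset.univ.sup' Finset.univ_nonempty
        (fun k => Real.exp (t * ∑ i, boolSign (σ i) * v k i ω)) ∂μ :=
        (integral_finsetSum _ fun σ _ => hi σ).symm
    _ ≤ ∫ _, 2 ^ m * (N * Real.exp (m * t ^ 2 / 2)) ∂μ :=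
        integral_mono (integrable_finsetSum _ fun σ _ => hi σ) (integrable_const _) fun ω =>
          sum_sup_exp_boolSign_le (fun k i => v k i ω) (fun k i => hv k i ω) (hN ω) t
    _ = _ := by simp

variable {Z : Type*} [MeasurableSpace Z]

/-- Symmetrization by a ghost sample: exchanging the entries of a pair `P i` with its ghost
changes the sign of the `i`-th term and preserves the law of the double sample. -/
theorem integral_sup_exp_deviation_le (D : Measure Z) [IsProbabilityMeasure D] {m : ℕ}
    (g : ι → Z → ℝ) (hg : ∀ k, Measurable (g k)) (hg0 : ∀ k z, 0 ≤ g k z)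
    (hg1 : ∀ k z, g k z ≤ 1) (t B : ℝ)
    (hB : ∀ P : Fin m → Z × Z, ∑ σ : Fin m → Bool, Finset.univ.sup' Finset.univ_nonempty
        (fun k => Real.exp (t * ∑ i, boolSign (σ i) * (g k (P i).2 - g k (P i).1))) ≤
      2 ^ m * B) :
    ∫ S, Finset.univ.sup' Finset.univ_nonempty
        (fun k => Real.exp (t * ∑ i, (∫ z, g k z ∂D - g k (S i)))) ∂(Measure.pi fun _ : Fin m => D)
      ≤ B := by
  set μ : Measure (Fin m → Z) := Measure.pi fun _ : Fin m => D with hμ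
  let Φ : (Fin m → Bool) → (Fin m → Z × Z) → ℝ := fun σ P =>
    Finset.univ.sup' Finset.univ_nonempty
      fun k => Real.exp (t * ∑ i, boolSign (σ i) * (g k (P i).2 - g k (P i).1))
  have hdiff : ∀ k z z', |g k z' - g k z| ≤ 1 := fun k z z' => by
    rw [abs_le]
    constructor <;> linarith [hg0 k z, hg0 k z', hg1 k z, hg1 k z']
  have hΦm : ∀ σ, Measurable (Φ σ) := fun σ => measurable_sup'_univ fun k => by fun_prop
  have hΦi : ∀ (ν : Measure (Fin m → Z × Z)) [IsProbabilityMeasure ν] σ,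
      Integrable (Φ σ) ν := fun ν _ σ =>
    integrable_sup_exp ν (fun k => by fun_prop) fun k P =>
      (le_abs_self _).trans (abs_mul_sum_boolSign_le t σ fun i => hdiff k _ _)
  let ν : Measure (Fin m → Z × Z) := Measure.pi fun _ => D.prod D
  have hswap : ∀ σ, ∫ P, Φ σ P ∂ν = ∫ P, Φ (fun _ => true) P ∂ν := by
    intro σ
    have hmp : MeasurePreserving
        (fun (P : Fin m → Z × Z) i => (if σ i then id else Prod.swap) (P i)) ν ν := by
      refine measurePreserving_pi _ _ fun i => ?_
      cases σ i
      · simpa using Measure.measurePreserving_swap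
      · simpa using MeasurePreserving.id _
    rw [← hmp.map_eq, integral_map hmp.measurable.aemeasurable
      (by rw [hmp.map_eq]; exact (hΦm _).aestronglyMeasurable), hmp.map_eq]
    refine integral_congr_ae (Filter.Eventually.of_forall fun P => ?_)
    simp only [Φ]
    congr 1
    funext k
    congr 2
    refine Finset.sum_congr rfl fun i _ => ?_
    cases h : σ i <;> simp [boolSign]
  have hsym : ∫ P, Φ (fun _ => true) P ∂ν ≤ B := by
    have h1 : ∑ σ, ∫ P, Φ σ P ∂ν = 2 ^ m * ∫ P, Φ (fun _ => true) P ∂ν := by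
      simp_rw [hswap]
      simp
    have h2 : ∑ σ, ∫ P, Φ σ P ∂ν ≤ 2 ^ m * B := by
      rw [← integral_finsetSum _ fun σ _ => hΦi ν σ]
      calc _ ≤ ∫ _, 2 ^ m * B ∂ν :=
            integral_mono (integrable_finsetSum _ fun σ _ => hΦi ν σ) (integrable_const _) hB
        _ = _ := by simp
    rw [h1] at h2
    exact le_of_mul_le_mul_left h2 (by positivity)
  refine le_trans ?_ hsym
  have hmp : MeasurePreserving (MeasurableEquiv.arrowProdEquivProdArrow Z Z (Fin m)) ν
      (μ.prod μ) := measurePreserving_arrowProdEquivProdArrow Z Z (Fin m) _ _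
  rw [← hmp.symm.integral_comp' (Φ fun _ => true)]
  have hΦ' : Integrable (fun p : (Fin m → Z) × (Fin m → Z) => Φ (fun _ => true)
      ((MeasurableEquiv.arrowProdEquivProdArrow Z Z (Fin m)).symm p)) (μ.prod μ) :=
    hmp.symm.integrable_comp_of_integrable (hΦi ν _)
  rw [integral_prod _ hΦ']
  have hmean : ∀ k (S : Fin m → Z), t * ∑ i, (∫ z, g k z ∂D - g k (S i)) =
      ∫ S', t * ∑ i, (g k (S' i) - g k (S i)) ∂μ := by
    intro k S
    have hi : ∀ i, Integrable (fun S' : Fin m → Z => g k (S' i)) μ := fun i =>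
      integrable_of_abs_le (C := 1) μ (by fun_prop) fun S' => by
        rw [abs_of_nonneg (hg0 k _)]
        exact hg1 k _
    have hsum : ∫ S', ∑ i, (g k (S' i) - g k (S i)) ∂μ =
        ∑ i, ∫ S', (g k (S' i) - g k (S i)) ∂μ :=
      integral_finsetSum _ fun i _ => (hi i).sub (integrable_const _)
    rw [integral_const_mul, hsum]
    congr 1
    refine Finset.sum_congr rfl fun i _ => ?_
    rw [integral_sub (hi i) (integrable_const _)]
    have := (measurePreserving_eval (fun _ : Fin m => D) i).map_eq
    congr 1
    · conv_lhs => rw [← this]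
      rw [integral_map (measurable_pi_apply i).aemeasurable
        (hg k).aestronglyMeasurable]
    · simp
  refine integral_mono ?_ hΦ'.integral_prod_left fun S => ?_
  · refine integrable_sup_exp μ (C := |t| * m) (fun k => by fun_prop) fun k S => ?_
    refine (le_abs_self _).trans ?_
    have hE0 : 0 ≤ ∫ z, g k z ∂D := integral_nonneg (hg0 k)
    have hE1 : ∫ z, g k z ∂D ≤ 1 := integral_le_one D (hg k) (hg0 k) (hg1 k)
    have := abs_mul_sum_boolSign_le t (fun _ : Fin m => true)
      (v := fun i => ∫ z, g k z ∂D - g k (S i)) fun i => by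
        rw [abs_le]
        constructor <;> linarith [hg0 k (S i), hg1 k (S i)]
    simpa [boolSign] using this
  · simp only [hmean]
    refine (sup_exp_integral_le μ (C := |t| * m) (fun k => by fun_prop) fun k S' => ?_).trans ?_
    · have := abs_mul_sum_boolSign_le t (fun _ : Fin m => true)
        (v := fun i => g k (S' i) - g k (S i)) fun i => hdiff k _ _
      simpa [boolSign] using this
    · refine le_of_eq (integral_congr_ae (Filter.Eventually.of_forall fun S' => ?_))
      simp [Φ, boolSign, MeasurableEquiv.arrowProdEquivProdArrow,
        Equiv.arrowProdEquivProdArrow]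

/-- A one-sided uniform deviation inequality for a finite class, from the symmetrized exponential
moment by Markov's inequality; the exponent is optimal at `t = ε`. -/
theorem measureReal_exists_deviation_le (D : Measure Z) [IsProbabilityMeasure D] {m : ℕ}
    (g : ι → Z → ℝ) (hg : ∀ k, Measurable (g k)) (hg0 : ∀ k z, 0 ≤ g k z)
    (hg1 : ∀ k z, g k z ≤ 1) {ε N : ℝ} (hε : 0 ≤ ε)
    (hB : ∀ P : Fin m → Z × Z, ∑ σ : Fin m → Bool, Finset.univ.sup' Finset.univ_nonempty
        (fun k => Real.exp (ε * ∑ i, boolSign (σ i) * (g k (P i).2 - g k (P i).1))) ≤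
      2 ^ m * (N * Real.exp (m * ε ^ 2 / 2))) :
    (Measure.pi fun _ : Fin m => D).real
        {S | ∃ k, m * ε ≤ ∑ i, (∫ z, g k z ∂D - g k (S i))} ≤
      N * Real.exp (-(m * ε ^ 2 / 2)) := by
  set μ : Measure (Fin m → Z) := Measure.pi fun _ : Fin m => D with hμ
  let F : (Fin m → Z) → ℝ := fun S => Finset.univ.sup' Finset.univ_nonempty
        (fun k => Real.exp (ε * ∑ i, (∫ z, g k z ∂D - g k (S i))))
  have hFint : Integrable F μ := by
    refine integrable_sup_exp μ (C := ε * ∑ _i : Fin m, (1 : ℝ)) (fun k => by fun_prop)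
      fun k S => ?_
    gcongr with i
    have hE1 : ∫ z, g k z ∂D ≤ 1 := integral_le_one D (hg k) (hg0 k) (hg1 k)
    linarith [hg0 k (S i)]
  have hF0 : ∀ S, 0 ≤ F S := fun S => (Real.exp_pos _).le.trans
    (le_sup'_univ (fun k => Real.exp (ε * ∑ i, (∫ z, g k z ∂D - g k (S i))))
      (Classical.arbitrary ι))
  have hmarkov := mul_meas_ge_le_integral_of_nonneg (μ := μ)
    (Filter.Eventually.of_forall hF0) hFint (Real.exp (ε * (m * ε)))
  have hbound := hmarkov.trans (integral_sup_exp_deviation_le D g hg hg0 hg1 ε _ hB)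
  have hsub : {S | ∃ k, m * ε ≤ ∑ i, (∫ z, g k z ∂D - g k (S i))} ⊆
      {S | Real.exp (ε * (m * ε)) ≤ F S} := by
    rintro S ⟨k, hk⟩
    refine le_trans ?_ (le_sup'_univ
      (fun k => Real.exp (ε * ∑ i, (∫ z, g k z ∂D - g k (S i)))) k)
    exact Real.exp_le_exp.2 (mul_le_mul_of_nonneg_left hk hε)
  refine (measureReal_mono hsub).trans ?_
  rw [← le_div_iff₀' (Real.exp_pos _)] at hbound
  refine hbound.trans (le_of_eq ?_)
  rw [mul_div_assoc, ← Real.exp_sub]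
  ring_nf

end PerturbMAP

/-! ### The error probability of the decoder -/

namespace PerturbMAP

variable {X Y : Type*} {d : ℕ}

/-- A set of noise vectors defined through the decoder is a finite union of sets on which all
comparisons of perturbed scores are prescribed. -/
theorem measurableSet_decoder {out : X → Finset Y} (hout : ∀ x, (out x).Nonempty)
    (φ : X → Y → EuclideanSpace ℝ (Fin d)) (w : EuclideanSpace ℝ (Fin d)) (x : X)
    (p : Y → Prop) : MeasurableSet {γ : out x → ℝ | p (decoder hout φ w x γ)} := by
  let cmp : (out x → ℝ) → (out x × out x → Prop) := fun γ q =>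
    perturbedScore out φ w x γ q.2 ≤ perturbedScore out φ w x γ q.1
  have hcmp : Measurable cmp := by
    refine measurable_pi_iff.2 fun q => measurableSet_setOfPred.1 ?_
    exact measurableSet_le (by unfold perturbedScore; fun_prop)
      (by unfold perturbedScore; fun_prop)
  have : {γ : out x → ℝ | p (decoder hout φ w x γ)} =
      cmp ⁻¹' (cmp '' {γ : out x → ℝ | p (decoder hout φ w x γ)}) := by
    refine Set.Subset.antisymm (Set.subset_preimage_image _ _) ?_
    rintro γ ⟨γ', hγ', h⟩
    have : decoder hout φ w x γ' = decoder hout φ w x γ :=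
      decoder_congr hout φ fun y y' => iff_of_eq (congrFun h (y, y'))
    simpa [this] using hγ'
  rw [this]
  exact hcmp (Set.toFinite _).measurableSet

/-- The indicator that the decoder errs on the labelled example `p` under the noise `γ`. -/
noncomputable def errorIndicator {out : X → Finset Y} (hout : ∀ x, (out x).Nonempty)
    (φ : X → Y → EuclideanSpace ℝ (Fin d)) (w : EuclideanSpace ℝ (Fin d)) (p : X × Y)
    (γ : out p.1 → ℝ) : ℝ :=
  {γ : out p.1 → ℝ | p.2 ≠ decoder hout φ w p.1 γ}.indicator 1 γ

section

variable {out : X → Finset Y} (hout : ∀ x, (out x).Nonempty)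
  (φ : X → Y → EuclideanSpace ℝ (Fin d)) (w : EuclideanSpace ℝ (Fin d)) (p : X × Y)

theorem measurable_errorIndicator : Measurable (errorIndicator hout φ w p) :=
  measurable_one.indicator (measurableSet_decoder hout φ w p.1 fun y => p.2 ≠ y)

theorem errorIndicator_nonneg (γ : out p.1 → ℝ) : 0 ≤ errorIndicator hout φ w p γ :=
  Set.indicator_nonneg (fun _ _ => zero_le_one) γ

theorem errorIndicator_le_one (γ : out p.1 → ℝ) : errorIndicator hout φ w p γ ≤ 1 :=
  Set.indicator_le_self' (fun _ _ => zero_le_one) γ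

theorem errorProb_one_eq_integral :
    errorProb hout φ 1 w p = ∫ γ, errorIndicator hout φ w p γ ∂(noise out 1 p.1) := by
  unfold errorIndicator errorProb
  exact (integral_indicator_one
    (measurableSet_decoder hout φ w p.1 fun y => p.2 ≠ y)).symm

theorem errorProb_nonneg (β : ℝ) : 0 ≤ errorProb hout φ β w p :=
  measureReal_nonneg

theorem errorProb_one_le_one : errorProb hout φ 1 w p ≤ 1 :=
  measureReal_le_one

/-- Only the ratio of the weights to the scale of the noise matters. -/
theorem errorProb_eq_errorProb_one {β : ℝ} (hβ : 0 < β) :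
    errorProb hout φ β w p = errorProb hout φ 1 (β⁻¹ • w) p := by
  unfold errorProb
  rw [← map_smul_noise_one out hβ, map_measureReal_apply (by fun_prop)
    (measurableSet_decoder hout φ w p.1 fun y => p.2 ≠ y)]
  congr 1
  ext γ
  have : decoder hout φ w p.1 (fun y => β * γ y) = decoder hout φ (β⁻¹ • w) p.1 γ := by
    refine decoder_congr hout φ fun y y' => ?_
    have h : ∀ y : out p.1, perturbedScore out φ w p.1 (fun y => β * γ y) y =
        β * perturbedScore out φ (β⁻¹ • w) p.1 γ y := by
      intro y
      simp only [perturbedScore, inner_smul_right]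
      field_simp
    rw [h, h, mul_le_mul_iff_right₀ hβ]
  simp [this]

end

/-- Off the null event of a tie at `w`, the decoded output does not change under small changes of
`w`. -/
theorem continuous_errorProb_one {out : X → Finset Y} (hout : ∀ x, (out x).Nonempty)
    (φ : X → Y → EuclideanSpace ℝ (Fin d)) (p : X × Y) :
    Continuous fun w => errorProb hout φ 1 w p := by
  simp_rw [errorProb_one_eq_integral]
  refine continuous_iff_continuousAt.2 fun w => ?_
  refine continuousAt_of_dominated (bound := fun _ => 1)
    (Filter.Eventually.of_forall fun w' =>
      (measurable_errorIndicator hout φ w' p).aestronglyMeasurable)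
    (Filter.Eventually.of_forall fun w' => Filter.Eventually.of_forall fun γ => ?_)
    (integrable_const _) ?_
  · rw [Real.norm_of_nonneg (errorIndicator_nonneg hout φ w' p γ)]
    exact errorIndicator_le_one hout φ w' p γ
  have hties : ∀ᵐ γ ∂(noise out 1 p.1), ∀ y y' : out p.1, y ≠ y' →
      perturbedScore out φ w p.1 γ y ≠ perturbedScore out φ w p.1 γ y' := by
    refine ae_all_iff.2 fun y => ae_all_iff.2 fun y' => ?_
    by_cases hy : y = y'
    · exact Filter.Eventually.of_forall fun γ h => absurd hy h
    · have h := noise_tie_null out p.1 hy (inner ℝ (φ p.1 y') w - inner ℝ (φ p.1 y) w)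
      filter_upwards [measure_eq_zero_iff_ae_notMem.1 h] with γ hγ _ heq
      refine hγ ?_
      simp only [perturbedScore] at heq
      linarith
  filter_upwards [hties] with γ hγ
  have hev : ∀ᶠ w' in nhds w, ∀ y y' : out p.1,
      perturbedScore out φ w' p.1 γ y' ≤ perturbedScore out φ w' p.1 γ y ↔
        perturbedScore out φ w p.1 γ y' ≤ perturbedScore out φ w p.1 γ y := by
    refine Filter.eventually_all.2 fun y => Filter.eventually_all.2 fun y' => ?_
    have hc : ∀ y : out p.1, Continuous fun w' => perturbedScore out φ w' p.1 γ y := by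
      intro y
      unfold perturbedScore
      fun_prop
    by_cases hy : y = y'
    · exact Filter.Eventually.of_forall fun w' => by simp [hy]
    rcases lt_or_gt_of_ne (hγ y y' hy) with h | h
    · filter_upwards [(hc y).continuousAt.eventually_lt (hc y').continuousAt h] with w' hw'
      exact iff_of_false hw'.not_ge h.not_ge
    · filter_upwards [(hc y').continuousAt.eventually_lt (hc y).continuousAt h] with w' hw'
      exact iff_of_true hw'.le h.le
  refine continuousAt_const.congr (f := fun _ => errorIndicator hout φ w p γ) ?_
  filter_upwards [hev] with w' hw'
  have : decoder hout φ w' p.1 γ = decoder hout φ w p.1 γ := decoder_congr hout φ hw'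
  refine Set.indicator_eq_indicator ?_ rfl
  change p.2 ≠ decoder hout φ w p.1 γ ↔ p.2 ≠ decoder hout φ w' p.1 γ
  rw [this]

/-- The exponential moment of the symmetrized process, on a fixed double sample. The noise enters
as one more average, over independent noise vectors at the `2 * m` inputs, and for fixed noise the
zero-one losses of sparse weights take few values. -/
theorem sum_sup_exp_errorProb_le {s m r : ℕ} (hd : 1 ≤ d) {out : X → Finset Y}
    (hout : ∀ x, (out x).Nonempty) (hr : ∀ x, (out x).card ≤ r)
    (φ : X → Y → EuclideanSpace ℝ (Fin d)) {ι : Type*} [Fintype ι] [Nonempty ι]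
    (u : ι → EuclideanSpace ℝ (Fin d)) (hu : ∀ k, IsSparse s (u k))
    (P : Fin m → (X × Y) × (X × Y)) (t : ℝ) :
    ∑ σ : Fin m → Bool, Finset.univ.sup' Finset.univ_nonempty
        (fun k => Real.exp (t * ∑ i, boolSign (σ i) *
          (errorProb hout φ 1 (u k) (P i).2 - errorProb hout φ 1 (u k) (P i).1))) ≤
      2 ^ m * (((d * (2 * m * (r * (r - 1)) + 1)) ^ s : ℕ) * Real.exp (m * t ^ 2 / 2)) := by
  classical
  let q : Fin m × Bool → X × Y := fun j => if j.2 then (P j.1).2 else (P j.1).1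
  let μ : Measure (∀ j, out (q j).1 → ℝ) := Measure.pi fun j => noise out 1 (q j).1
  let e : ι → Fin m × Bool → (∀ j, out (q j).1 → ℝ) → ℝ := fun k j ω =>
    errorIndicator hout φ (u k) (q j) (ω j)
  have hem : ∀ k j, Measurable (e k j) := fun k j =>
    (measurable_errorIndicator hout φ (u k) (q j)).comp (measurable_pi_apply j)
  have he0 : ∀ k j ω, 0 ≤ e k j ω := fun k j ω => errorIndicator_nonneg hout φ (u k) (q j) (ω j)
  have he1 : ∀ k j ω, e k j ω ≤ 1 := fun k j ω => errorIndicator_le_one hout φ (u k) (q j) (ω j)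
  have hei : ∀ k j, Integrable (e k j) μ := fun k j =>
    integrable_of_abs_le (C := 1) μ (hem k j) fun ω => by
      rw [abs_of_nonneg (he0 k j ω)]
      exact he1 k j ω
  have heint : ∀ k j, ∫ ω, e k j ω ∂μ = errorProb hout φ 1 (u k) (q j) := by
    intro k j
    rw [errorProb_one_eq_integral]
    have := (measurePreserving_eval (fun j => noise out 1 (q j).1) j).map_eq
    conv_rhs => rw [← this]
    rw [integral_map (measurable_pi_apply j).aemeasurable
      (measurable_errorIndicator hout φ (u k) (q j)).aestronglyMeasurable]
  let v : ι → Fin m → (∀ j, out (q j).1 → ℝ) → ℝ := fun k i ω =>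
    e k (i, true) ω - e k (i, false) ω
  have hvint : ∀ k i, ∫ ω, v k i ω ∂μ =
      errorProb hout φ 1 (u k) (P i).2 - errorProb hout φ 1 (u k) (P i).1 := by
    intro k i
    simp only [v]
    rw [integral_sub (hei _ _) (hei _ _), heint, heint]
    simp [q]
  have hcard : ∀ ω, (Finset.univ.image fun k i => v k i ω).card ≤
      (d * (2 * m * (r * (r - 1)) + 1)) ^ s := by
    intro ω
    let L : (Fin m × Bool → Y) → Fin m → ℝ := fun f i =>
      (if (q (i, true)).2 ≠ f (i, true) then 1 else 0) -
        (if (q (i, false)).2 ≠ f (i, false) then 1 else 0)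
    have himg : (Finset.univ.image fun k i => v k i ω) =
        ((Finset.univ.image u).image
          fun w j => decoder hout φ w (q j).1 (ω j)).image L := by
      rw [Finset.image_image, Finset.image_image]
      refine congrArg (fun F => Finset.univ.image F) ?_
      funext k i
      simp [v, e, L, errorIndicator, Set.indicator]
    rw [himg]
    refine Finset.card_image_le.trans ((card_decoder_image_le (s := s) hd hout φ _ ω _ ?_).trans ?_)
    · intro w hw
      obtain ⟨k, -, rfl⟩ := Finset.mem_image.1 hw
      exact hu k
    · have : ∑ j, ((out (q j).1).card * (out (q j).1).card - (out (q j).1).card) ≤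
          2 * m * (r * (r - 1)) := by
        calc _ ≤ ∑ _j : Fin m × Bool, r * (r - 1) := by
              refine Finset.sum_le_sum fun j _ => ?_
              rw [← Nat.mul_sub_one]
              exact Nat.mul_le_mul (hr _) (Nat.sub_le_sub_right (hr _) 1)
          _ = _ := by
              simp [mul_comm]
      gcongr
  have := sum_sup_exp_integral_le μ v (fun k i => (hem k _).sub (hem k _))
    (fun k i ω => by
      rw [abs_le]
      constructor <;> simp only [v] <;>
        linarith [he0 k (i, true) ω, he0 k (i, false) ω, he1 k (i, true) ω, he1 k (i, false) ω])
    hcard t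
  simpa only [hvint] using this

end PerturbMAP

/-! ### Uniform deviation over sparse weights -/

namespace PerturbMAP

/-- The statistical error term beats both the logarithm of the number of decoding patterns on a
double sample and the logarithm of the confidence. -/
theorem card_patterns_mul_exp_le {d s m r : ℕ} (hd : 1 ≤ d) (hm : 1 ≤ m) (hr : 1 ≤ r) {δ : ℝ}
    (hδ₀ : 0 < δ) (hδ₁ : δ < 1) :
    (((d * (2 * m * (r * (r - 1)) + 1)) ^ s : ℕ) : ℝ) *
      Real.exp (-(m * epsilon d s m r δ ^ 2 / 2)) ≤ δ := by
  have hd' : (1 : ℝ) ≤ d := by exact_mod_cast hd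
  have hm' : (1 : ℝ) ≤ m := by exact_mod_cast hm
  have hr' : (1 : ℝ) ≤ r := by exact_mod_cast hr
  have hmr : (1 : ℝ) ≤ m * r := one_le_mul_of_one_le_of_one_le hm' hr'
  have hld : 0 ≤ Real.log d := Real.log_nonneg hd'
  have hlmr : 0 ≤ Real.log (m * r) := Real.log_nonneg hmr
  set A : ℝ := s * (Real.log d + 2 * Real.log (m * r)) with hA
  set B : ℝ := Real.log (2 / δ) with hB
  have hA0 : 0 ≤ A := by positivity
  have hB1 : -Real.log δ ≤ B := by
    rw [hB, Real.log_div two_ne_zero hδ₀.ne']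
    linarith [Real.log_pos one_lt_two]
  have hB0 : 0 ≤ B := by linarith [Real.log_neg hδ₀ hδ₁]
  -- counting ordered pairs of distinct outputs makes this hold with equality at `m = r = 1`,
  -- where the logarithm in `epsilon` vanishes
  have hnat : 2 * m * (r * (r - 1)) + 1 ≤ (m * r) ^ 4 := by
    obtain ⟨k, rfl⟩ : ∃ k, r = k + 1 := ⟨r - 1, by omega⟩
    rw [Nat.add_sub_cancel, mul_pow]
    have h1 : m ≤ m ^ 4 := Nat.le_self_pow (by norm_num) m
    have h2 : 2 * ((k + 1) * k) + 1 ≤ (k + 1) ^ 4 := by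
      ring_nf
      nlinarith [Nat.zero_le (k ^ 3), Nat.zero_le (k ^ 4)]
    calc 2 * m * ((k + 1) * k) + 1 ≤ m * (2 * ((k + 1) * k) + 1) := by nlinarith
      _ ≤ _ := Nat.mul_le_mul h1 h2
  have hcard : (((d * (2 * m * (r * (r - 1)) + 1)) ^ s : ℕ) : ℝ) ≤ Real.exp (2 * A) := by
    have h1 : (((d * (2 * m * (r * (r - 1)) + 1)) ^ s : ℕ) : ℝ) ≤ (d * (m * r) ^ 4) ^ s := by
      exact_mod_cast Nat.pow_le_pow_left (Nat.mul_le_mul_left d hnat) s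
    refine h1.trans ?_
    rw [← Real.log_le_iff_le_exp (by positivity), Real.log_pow,
      Real.log_mul (by positivity) (by positivity), Real.log_pow, hA]
    push_cast
    have : 0 ≤ (s : ℝ) * Real.log d := by positivity
    nlinarith
  have hε : 4 * A + 9 / 2 * B ≤ m * epsilon d s m r δ ^ 2 := by
    have h1 : √(A / m) ^ 2 = A / m := Real.sq_sqrt (by positivity)
    have h2 : √(B / (2 * m)) ^ 2 = B / (2 * m) := Real.sq_sqrt (by positivity)
    have h3 : 0 ≤ √(A / m) * √(B / (2 * m)) := by positivity
    have h4 : 4 * (A / m) + 9 * (B / (2 * m)) ≤ epsilon d s m r δ ^ 2 := by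
      unfold epsilon
      rw [← hA, ← hB]
      nlinarith
    calc 4 * A + 9 / 2 * B = m * (4 * (A / m) + 9 * (B / (2 * m))) := by
          field_simp
      _ ≤ _ := by gcongr
  calc _ ≤ Real.exp (2 * A) * Real.exp (-(m * epsilon d s m r δ ^ 2 / 2)) := by gcongr
    _ = Real.exp (2 * A - m * epsilon d s m r δ ^ 2 / 2) := by
      rw [← Real.exp_add, sub_eq_add_neg]
    _ ≤ Real.exp (Real.log δ) := Real.exp_le_exp.2 (by linarith)
    _ = δ := Real.exp_log hδ₀

theorem isSparse_zero {d : ℕ} (s : ℕ) : IsSparse s (0 : EuclideanSpace ℝ (Fin d)) := by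
  simp [IsSparse]

theorem IsSparse.smul {d s : ℕ} {w : EuclideanSpace ℝ (Fin d)} (hw : IsSparse s w) (a : ℝ) :
    IsSparse s (a • w) := by
  refine (Set.ncard_le_ncard (fun j hj => ?_) (Set.toFinite _)).trans hw
  simp only [Set.mem_ofPred_eq, PiLp.smul_apply, smul_eq_mul] at hj ⊢
  exact right_ne_zero_of_mul hj

variable {X Y : Type*} [MeasurableSpace X] [MeasurableSpace Y] {d : ℕ}

/-- The weights are divided by their scale, so that all decoders see the same standard noise; by
continuity of both losses in the rescaled weights, a dense sequence of them decides the event. -/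
theorem exists_seq_forall_le_iff {s m : ℕ} {out : X → Finset Y}
    (hout : ∀ x, (out x).Nonempty) (φ : X → Y → EuclideanSpace ℝ (Fin d))
    (β : EuclideanSpace ℝ (Fin d) → ℝ) (hβ : ∀ w, 0 < β w)
    (hmeas : ∀ w, IsSparse s w → Measurable (errorProb hout φ (β w) w))
    (D : Measure (X × Y)) [IsProbabilityMeasure D] (ε : ℝ) :
    ∃ u : ℕ → EuclideanSpace ℝ (Fin d), (∀ k, IsSparse s (u k)) ∧
      (∀ k, Measurable (errorProb hout φ 1 (u k))) ∧
      ∀ S : Fin m → X × Y,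
        (∀ w, IsSparse s w →
          expectedLoss hout φ (β w) w D ≤ empiricalLoss hout φ (β w) w S + ε) ↔
        ∀ k, expectedLoss hout φ 1 (u k) D ≤ empiricalLoss hout φ 1 (u k) S + ε := by
  let U : Set (EuclideanSpace ℝ (Fin d)) := (fun w => (β w)⁻¹ • w) '' {w | IsSparse s w}
  have hscale : ∀ w, errorProb hout φ (β w) w = errorProb hout φ 1 ((β w)⁻¹ • w) := fun w =>
    funext fun p => errorProb_eq_errorProb_one hout φ w p (hβ w)
  have hUs : ∀ u : U, IsSparse s (u : EuclideanSpace ℝ (Fin d)) := by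
    rintro ⟨_, w, hw, rfl⟩
    exact hw.smul _
  have hUm : ∀ u : U, Measurable (errorProb hout φ 1 (u : EuclideanSpace ℝ (Fin d))) := by
    rintro ⟨_, w, hw, rfl⟩
    rw [← hscale]
    exact hmeas w hw
  have : Nonempty U := ⟨⟨_, 0, isSparse_zero s, rfl⟩⟩
  have hcE : Continuous fun u : U => expectedLoss hout φ 1 (u : EuclideanSpace ℝ (Fin d)) D := by
    unfold expectedLoss
    refine continuous_of_dominated (bound := fun _ => 1) (fun u => (hUm u).aestronglyMeasurable)
      (fun u => Filter.Eventually.of_forall fun p => ?_) (integrable_const _)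
      (Filter.Eventually.of_forall fun p =>
        (continuous_errorProb_one hout φ p).comp continuous_subtype_val)
    rw [Real.norm_of_nonneg (errorProb_nonneg hout φ _ p 1)]
    exact errorProb_one_le_one hout φ _ p
  have hcS : ∀ S : Fin m → X × Y, Continuous fun u : U =>
      empiricalLoss hout φ 1 (u : EuclideanSpace ℝ (Fin d)) S := by
    intro S
    unfold empiricalLoss
    exact continuous_const.mul (continuous_finsetSum _ fun i _ =>
      (continuous_errorProb_one hout φ (S i)).comp continuous_subtype_val)
  refine ⟨fun k => TopologicalSpace.denseSeq U k, fun k => hUs _, fun k => hUm _, fun S => ?_⟩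
  have hU : (∀ w, IsSparse s w →
        expectedLoss hout φ (β w) w D ≤ empiricalLoss hout φ (β w) w S + ε) ↔
      ∀ u : U, expectedLoss hout φ 1 (u : EuclideanSpace ℝ (Fin d)) D ≤
        empiricalLoss hout φ 1 (u : EuclideanSpace ℝ (Fin d)) S + ε := by
    have hE : ∀ w, expectedLoss hout φ (β w) w D = expectedLoss hout φ 1 ((β w)⁻¹ • w) D :=
      fun w => by unfold expectedLoss; rw [hscale]
    have hS : ∀ w, empiricalLoss hout φ (β w) w S = empiricalLoss hout φ 1 ((β w)⁻¹ • w) S :=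
      fun w => by unfold empiricalLoss; rw [hscale]
    constructor
    · rintro h ⟨_, w, hw, rfl⟩
      simpa only [hE, hS] using h w hw
    · intro h w hw
      rw [hE, hS]
      exact h ⟨_, w, hw, rfl⟩
  rw [hU]
  refine ⟨fun h k => h _, fun h u => ?_⟩
  have hcl : IsClosed {u : U | expectedLoss hout φ 1 (u : EuclideanSpace ℝ (Fin d)) D ≤
      empiricalLoss hout φ 1 (u : EuclideanSpace ℝ (Fin d)) S + ε} :=
    isClosed_le hcE ((hcS S).add continuous_const)
  exact hcl.closure_subset_iff.2 (Set.range_subset_iff.2 h)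
    (TopologicalSpace.denseRange_denseSeq U u)

/-- The deviation bound for finitely many sparse weights under standard noise; it does not depend
on their number. -/
theorem measure_exists_lt_le {s m r : ℕ} (hd : 1 ≤ d) (hm : 1 ≤ m) {out : X → Finset Y}
    (hout : ∀ x, (out x).Nonempty) (hr : ∀ x, (out x).card ≤ r)
    (φ : X → Y → EuclideanSpace ℝ (Fin d)) {ι : Type*} [Fintype ι] [Nonempty ι]
    (u : ι → EuclideanSpace ℝ (Fin d)) (hu : ∀ k, IsSparse s (u k))
    (hmeas : ∀ k, Measurable (errorProb hout φ 1 (u k)))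
    (D : Measure (X × Y)) [IsProbabilityMeasure D] {δ : ℝ} (hδ₀ : 0 < δ) (hδ₁ : δ < 1) :
    Measure.pi (fun _ : Fin m => D) {S | ∃ k, empiricalLoss hout φ 1 (u k) S +
        epsilon d s m r δ < expectedLoss hout φ 1 (u k) D} ≤ ENNReal.ofReal δ := by
  have hr1 : 1 ≤ r := by
    obtain ⟨p⟩ := nonempty_of_isProbabilityMeasure D
    exact (Finset.card_pos.2 (hout p.1)).trans_le (hr p.1)
  have hε : 0 ≤ epsilon d s m r δ := by
    unfold epsilon
    positivity
  have hm0 : (0 : ℝ) < m := by exact_mod_cast hm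
  have hdev := measureReal_exists_deviation_le D (m := m)
    (fun k => errorProb hout φ 1 (u k)) hmeas
    (fun k p => errorProb_nonneg hout φ (u k) p 1)
    (fun k p => errorProb_one_le_one hout φ (u k) p) hε
    (fun P => sum_sup_exp_errorProb_le hd hout hr φ u hu P _)
  rw [← ENNReal.ofReal_toReal (measure_ne_top (Measure.pi fun _ : Fin m => D) _)]
  refine ENNReal.ofReal_le_ofReal (le_trans (measureReal_mono ?_)
    (hdev.trans (card_patterns_mul_exp_le hd hm hr1 hδ₀ hδ₁)))
  rintro S ⟨k, hk⟩
  refine ⟨k, ?_⟩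
  rw [Finset.sum_sub_distrib, Finset.sum_const, Finset.card_univ, Fintype.card_fin,
    nsmul_eq_mul]
  unfold empiricalLoss expectedLoss at hk
  have := mul_lt_mul_of_pos_left hk hm0
  rw [mul_add, ← mul_assoc, mul_one_div_cancel hm0.ne', one_mul] at this
  linarith

end PerturbMAP

open PerturbMAP in
theorem mainTheorem2 {X Y : Type*} [MeasurableSpace X] [MeasurableSpace Y]
    (d s m r : ℕ) (hd : 1 ≤ d) (hm : 1 ≤ m)
    (out : X → Finset Y) (hout : ∀ x, (out x).Nonempty) (hr : ∀ x, (out x).card ≤ r)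
    (φ : X → Y → EuclideanSpace ℝ (Fin d))
    (β : ℕ → EuclideanSpace ℝ (Fin d) → ℝ) (hβ : ∀ n w, 0 < β n w)
    (hmeas : ∀ w, PerturbMAP.IsSparse s w →
      Measurable (PerturbMAP.errorProb hout φ (β m w) w))
    (D : MeasureTheory.Measure (X × Y)) [MeasureTheory.IsProbabilityMeasure D]
    (δ : ℝ) (hδ₀ : 0 < δ) (hδ₁ : δ < 1) :
    MeasurableSet {S : Fin m → X × Y | ∀ w, PerturbMAP.IsSparse s w →
        PerturbMAP.expectedLoss hout φ (β m w) w D ≤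
          PerturbMAP.empiricalLoss hout φ (β m w) w S + PerturbMAP.epsilon d s m r δ} ∧
      ENNReal.ofReal (1 - δ) ≤
        MeasureTheory.Measure.pi (fun _ : Fin m => D)
          {S : Fin m → X × Y | ∀ w, PerturbMAP.IsSparse s w →
            PerturbMAP.expectedLoss hout φ (β m w) w D ≤
              PerturbMAP.empiricalLoss hout φ (β m w) w S + PerturbMAP.epsilon d s m r δ} := by
  obtain ⟨u, hus, hum, hiff⟩ := exists_seq_forall_le_iff (m := m) hout φ (β m) (hβ m) hmeas D
    (epsilon d s m r δ)
  simp_rw [hiff]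
  set μ := Measure.pi fun _ : Fin m => D
  have hmS : MeasurableSet {S : Fin m → X × Y | ∀ k, expectedLoss hout φ 1 (u k) D ≤
      empiricalLoss hout φ 1 (u k) S + epsilon d s m r δ} := by
    rw [Set.ofPred_forall]
    refine MeasurableSet.iInter fun k => measurableSet_le measurable_const ?_
    unfold empiricalLoss
    have := hum k
    fun_prop
  refine ⟨hmS, ?_⟩
  rw [← compl_compl {S : Fin m → X × Y | ∀ k, _}, prob_compl_eq_one_sub hmS.compl,
    ENNReal.ofReal_sub _ hδ₀.le, ENNReal.ofReal_one]
  refine tsub_le_tsub_left ?_ 1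
  -- the failure event is the increasing union of those of the initial segments of `u`
  let bad : ℕ → Set (Fin m → X × Y) := fun n => {S | ∃ k : Fin (n + 1),
    empiricalLoss hout φ 1 (u k) S + epsilon d s m r δ < expectedLoss hout φ 1 (u k) D}
  have hmono : Monotone bad := by
    rintro n n' hn S ⟨k, hk⟩
    exact ⟨Fin.castLE (by omega) k, hk⟩
  have hsub : {S : Fin m → X × Y | ∀ k, expectedLoss hout φ 1 (u k) D ≤
      empiricalLoss hout φ 1 (u k) S + epsilon d s m r δ}ᶜ ⊆ ⋃ n, bad n := by
    intro S hS
    simp only [Set.mem_compl_iff, Set.mem_ofPred_eq, not_forall, not_le] at hS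
    obtain ⟨k, hk⟩ := hS
    exact Set.mem_iUnion.2 ⟨k, Fin.last k, hk⟩
  refine (measure_mono hsub).trans ?_
  rw [hmono.measure_iUnion]
  exact iSup_le fun n => measure_exists_lt_le hd hm hout hr φ (fun k : Fin (n + 1) => u k)
    (fun k => hus k) (fun k => hum k) D hδ₀ hδ₁
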